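/- All graphs are finite, simple and undirected; $G$ and $G'$ may have different vertex sets, and an edge is identified with its pair of endpoints. **Community tree.** For $k\ge 2$, call two $k$-cliques of $G$ (vertex sets of complete subgraphs with $k$ vertices) adjacent if they share exactly $k-1$ vertices. Each connected component of the resulting graph on the $k$-cliques of $G$ is a $k$-community, and it spans the subgraph that is the union of its cliques. The only $1$-community is $G$ itself. For $1\le l\le k$, a $k$-community is nested in the $l$-community that contains all $l$-cliques contained in cliques of the $k$-community. Communities of different components or of different orders are different nodes, even if they span the same subgraph. With this nesting the communities of all orders form the community tree $T(G)$. A leaf is a community in which no other community is nested. **Persistence diagram.** Each leaf $\ell$ represents a component of the tree, namely the sequence of communities in which $\ell$ is nested. Its birth time $b_\ell$ is the order of $\ell$. Two components merge at the highest order at which they contain the same community. When two components merge, the one with the higher birth time survives and the other is eliminated; ties are broken by an arbitrary total order of the components with the same birth time. The death time $d_\ell$ is the order of the merging at which the component is eliminated, and $d_\ell=1$ if it is never eliminated. The persistence diagram $PD(T(G))$ is the multiset of the points $(d_\ell,b_\ell)\in\mathbb{R}^2$, over all leaves $\ell$, together with all points of the diagonal $\{(x,x):x\in\mathbb{R}\}$,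 each with countably infinite multiplicity. **Distance.** $d_B(T(G),T(G'))=\inf_\gamma\sup_{A}\|A-\gamma(A)\|_\infty$, where $\gamma$ ranges over the bijections of multisets $PD(T(G))\to PD(T(G'))$, $A$ ranges over $PD(T(G))$, and $\|(v_1,v_2)\|_\infty=\max\{|v_1|,|v_2|\}$. **Star numbers.** $RSN(G',G)$ is the least size of a set of vertices that meets every edge in $E(G)\setminus E(G')$. $ASN(G',G)$ is the least size of a set of vertices that meets every edge in $E(G')\setminus E(G)$. $TSN(G',G)=RSN(G',G)+ASN(G',G)$. **Theorem.** For any two finite graphs $G$ and $G'$, and any choice of the tie-breaking in the two persistence diagrams, $$d_B(T(G),T(G'))\le TSN(G',G).$$ -/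

import Mathlib

open scoped ENNReal

namespace CommunityTree

universe u

/-- A graph whose vertex set `G.verts` and edge set `G.edgeSet` live over a universe `α` of
potential vertices; two graphs over the same `α` may have different vertex sets. -/
abbrev Network (α : Type u) : Type u := (⊤ : SimpleGraph α).Subgraph

variable {α : Type u}

/-- `K` is the vertex set of a `k`-clique of `G`. -/
def IsKClique (G : Network α) (k : ℕ) (K : Finset α) : Prop :=
  (K : Set α) ⊆ G.verts ∧ G.spanningCoe.IsNClique k K

/-- The graph on the `k`-cliques of `G` in which two `k`-cliques are adjacent when they have
exactly `k - 1` vertices in common. -/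
def percolationGraph (G : Network α) (k : ℕ) : SimpleGraph {K : Finset α // IsKClique G k K} where
  Adj K L := ((K.1 : Set α) ∩ (L.1 : Set α)).ncard + 1 = k
  symm := ⟨fun K L h => by rwa [Set.inter_comm]⟩
  loopless := ⟨fun K h => by
    have hk := K.2.2.card_eq
    rw [Set.inter_self, Set.ncard_coe_finset] at h
    omega⟩

/-- The nodes of the community tree of `G`: the unique community of order `1`, which is the whole
graph `G`, and, for every `k ≥ 2`, one community for each connected component of the graph of
`k`-cliques. Nodes of different orders are different even if their subgraphs coincide. -/
inductive Community (G : Network α) : Type u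
  | whole : Community G
  | ofComponent (k : ℕ) (hk : 2 ≤ k) (c : (percolationGraph G k).ConnectedComponent) : Community G

namespace Community

variable {G : Network α}

/-- The order of a community. -/
def order : Community G → ℕ
  | whole => 1
  | ofComponent k _ _ => k

/-- The cliques of size `C.order` that form the community `C`. -/
def cliques : Community G → Set (Finset α)
  | whole => {K | IsKClique G 1 K}
  | ofComponent _ _ c => Subtype.val '' c.supp

/-- The subgraph of `G` that a community spans: `G` itself for order `1`, and the union of the
cliques of the community for order at least `2`. -/
def graph : Community G → Network α
  | whole => G
  | ofComponent k hk c => ⨆ K ∈ (ofComponent k hk c).cliques, (⊤ : Network α).induce (K : Set α)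

/-- The nesting relation of the community tree: `C` lies inside `D`, that is, `D` is the community
of order `D.order ≤ C.order` that contains all cliques of size `D.order` that are contained in
the cliques of `C`. -/
def Nested (C D : Community G) : Prop :=
  D.order ≤ C.order ∧ ∀ K ∈ C.cliques, ∀ L ⊆ K, L.card = D.order → L ∈ D.cliques

end Community

/-- The leaves of the community tree: the communities with no other community inside them. Each
leaf stands for the component of the tree that consists of the communities around this leaf. -/
def Leaf (G : Network α) : Type u := {C : Community G // ∀ D : Community G, D.Nested C → D = C}

/-- The birth time of a component of the tree: the order of its leaf. -/
def birth {G : Network α} (a : Leaf G) : ℕ := a.1.order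

/-- The order at which two components merge: the highest order of a community they share. -/
noncomputable def mergeOrder {G : Network α} (a b : Leaf G) : ℕ :=
  sSup {m | ∃ D : Community G, a.1.Nested D ∧ b.1.Nested D ∧ D.order = m}

/-- `elder a b` ("`a` survives when `a` and `b` merge") is an admissible rule for the merging of
components: a component with a higher birth time survives, and components with the same birth time
are ordered arbitrarily. -/
structure IsElderRule (G : Network α) (elder : Leaf G → Leaf G → Prop) : Prop where
  strictTotal : IsStrictTotalOrder (Leaf G) elder
  of_birth_lt : ∀ a b : Leaf G, birth b < birth a → elder a b

/-- Admissible rules exist: order by birth time and break ties by any strict total order. -/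
theorem exists_isElderRule (G : Network α) : ∃ elder, IsElderRule G elder := by
  classical
  refine ⟨fun a b => birth b < birth a ∨ (birth a = birth b ∧ WellOrderingRel a b), ?_, ?_⟩
  · refine { trichotomous := ?_, irrefl := ?_, trans := ?_ }
    · intro a b h₁ h₂
      rcases lt_trichotomy (birth a) (birth b) with h | h | h
      · exact absurd (Or.inl h) h₂
      · rcases trichotomous_of (WellOrderingRel (α := Leaf G)) a b with h' | h' | h'
        · exact absurd (Or.inr ⟨h, h'⟩) h₁
        · exact h'
        · exact absurd (Or.inr ⟨h.symm, h'⟩) h₂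
      · exact absurd (Or.inl h) h₁
    · rintro a (h | ⟨-, h⟩)
      · exact lt_irrefl _ h
      · exact irrefl _ h
    · rintro a b c (h | ⟨h, h'⟩) (g | ⟨g, g'⟩)
      · exact Or.inl (g.trans h)
      · exact Or.inl (g ▸ h)
      · exact Or.inl (h ▸ g)
      · exact Or.inr ⟨h.trans g, _root_.trans h' g'⟩
  · exact fun a b h => Or.inl h

/-- The death time of a component: the order of its first merging, going down from its leaf to the
root, with a component that survives this merging; it is `1` if there is none. -/
noncomputable def death {G : Network α} (elder : Leaf G → Leaf G → Prop) (a : Leaf G) : ℕ :=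
  sSup ({1} ∪ {m | ∃ b : Leaf G, elder b a ∧ m = mergeOrder a b})

/-- The points `(death, birth)` of the persistence diagram of the community tree of `G`, as a
family indexed by the components, so that points are counted with multiplicity. -/
noncomputable def diagramPoint (G : Network α) (elder : Leaf G → Leaf G → Prop) (a : Leaf G) :
    ℝ × ℝ :=
  ((death elder a : ℝ), (birth a : ℝ))

/-- The persistence diagram with points `p i`: the diagonal is added to it, each of its points
with countably infinite multiplicity. -/
def withDiagonal {ι : Type u} (p : ι → ℝ × ℝ) : ι ⊕ (ℝ × ℕ) → ℝ × ℝ :=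
  Sum.elim p (fun x => (x.1, x.1))

/-- The bottleneck distance of the persistence diagrams with points `p i` and `q j`. The distance
of `ℝ × ℝ` is that of the maximum norm. -/
noncomputable def bottleneckDist {ι κ : Type u} (p : ι → ℝ × ℝ) (q : κ → ℝ × ℝ) : ℝ≥0∞ :=
  ⨅ γ : (ι ⊕ (ℝ × ℕ)) ≃ (κ ⊕ (ℝ × ℕ)), ⨆ x, edist (withDiagonal p x) (withDiagonal q (γ x))

/-- The removal star number of `G'` and `G`: the least number of vertices that meet every edge of
`G` that is not an edge of `G'`. -/
noncomputable def RSN (G' G : Network α) : ℕ :=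
  sInf {n | ∃ V₀ : Finset α, V₀.card = n ∧ ∀ e ∈ G.edgeSet \ G'.edgeSet, ∃ v ∈ V₀, v ∈ e}

/-- The addition star number of `G'` and `G`: the least number of vertices that meet every edge of
`G'` that is not an edge of `G`. -/
noncomputable def ASN (G' G : Network α) : ℕ :=
  sInf {n | ∃ V₀ : Finset α, V₀.card = n ∧ ∀ e ∈ G'.edgeSet \ G.edgeSet, ∃ v ∈ V₀, v ∈ e}

/-- The total star number of `G'` and `G`. -/
noncomputable def TSN (G' G : Network α) : ℕ := RSN G' G + ASN G' G

end CommunityTree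

/-!
Let `V` be a vertex cover of the symmetric difference of the edge sets. Deleting `V` turns a clique
of one graph into a clique of the other that is smaller by at most `V.card`, and turns overlapping
cliques into overlapping cliques. Choosing a leaf above what is left of the branch of each leaf
therefore gives maps between the two community trees that lower all merging orders by at most
`V.card`, and that bring a leaf back to its own branch up to `2 * V.card`: the trees are
interleaved.

For interleaved merge trees, move the leaves of the first into the second, as a second family of
leaves of one and the same tree. Just above an order `d`, each branch carries at most one leaf of
either family that is still alive. Let `a` die at `d`. If the leaf of the other family in the branch
of `a` dies at `d` too, it is the partner of `a`. Otherwise it lives on below `d`, and so does the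
leaf `a'` to which `a` loses; then the leaf of the other family in the branch of `a'` has to die at
`d`, and it is the partner of `a`. The elder rules make the birth times of partners agree up to
`V.card`, and a leaf without a partner lives for at most `2 * V.card`, so that the diagonal is near.
-/

namespace CommunityTree

universe u

open scoped Function NNReal

section Bottleneck

variable {ι κ : Type u} {p : ι → ℝ × ℝ} {q : κ → ℝ × ℝ} {R : ι → κ → Prop} {δ : ℝ≥0}

/-- A `δ`-matching of the persistence diagrams with points `p i` and `q j`: a partial bijection
`R` that moves no point by more than `δ` and leaves only points at distance at most `δ` from the
diagonal unmatched. -/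
structure IsMatching (δ : ℝ≥0) (p : ι → ℝ × ℝ) (q : κ → ℝ × ℝ) (R : ι → κ → Prop) : Prop where
  biUnique : Relator.BiUnique R
  dist_le : ∀ i j, R i j → dist (p i) (q j) ≤ δ
  left_mem : ∀ i, (∀ j, ¬ R i j) → (p i).2 - (p i).1 ∈ Set.Icc 0 (2 * δ : ℝ)
  right_mem : ∀ j, (∀ i, ¬ R i j) → (q j).2 - (q j).1 ∈ Set.Icc 0 (2 * δ : ℝ)

/-- The label of a point of a diagram with points `p i`, where some of these points are labelled by
`u`: every other point is labelled by the first coordinate of the diagonal point nearest to it. -/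
noncomputable def diagramLabel {ζ : Type*} (p : ι → ℝ × ℝ) (u : ι → Option ζ) :
    ι ⊕ (ℝ × ℕ) → ζ ⊕ ℝ :=
  Sum.elim (fun i => (u i).elim (.inr (((p i).1 + (p i).2) / 2)) .inl) fun x => .inr x.1

section Label

variable {ζ : Type*} {u : ι → Option ζ}

theorem diagramLabel_eq_inl_iff {x : ι ⊕ (ℝ × ℕ)} {z : ζ} :
    diagramLabel p u x = .inl z ↔ ∃ i, x = .inl i ∧ u i = some z := by
  obtain i | x := x
  · cases h : u i <;> simp [diagramLabel, h]
  · simp [diagramLabel]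

theorem diagramLabel_eq_inr {x : ι ⊕ (ℝ × ℕ)} {t : ℝ} (h : diagramLabel p u x = .inr t) :
    (∃ i, x = .inl i ∧ u i = none ∧ ((p i).1 + (p i).2) / 2 = t) ∨ ∃ k, x = .inr (t, k) := by
  obtain i | x := x
  · cases hi : u i <;> simp_all [diagramLabel]
  · exact .inr ⟨x.2, congrArg Sum.inr (Prod.ext (Sum.inr_injective h) rfl)⟩

theorem nonempty_diagramLabel_fiber_inl {z : ζ} :
    Nonempty {x // diagramLabel p u x = .inl z} ↔ ∃ i, u i = some z := by
  simp only [nonempty_subtype, diagramLabel_eq_inl_iff]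
  exact ⟨fun ⟨_, i, _, hi⟩ => ⟨i, hi⟩, fun ⟨i, hi⟩ => ⟨_, i, rfl, hi⟩⟩

theorem subsingleton_diagramLabel_fiber_inl (hu : Relator.LeftUnique fun i z => u i = some z)
    (z : ζ) : Subsingleton {x // diagramLabel p u x = .inl z} := by
  refine ⟨fun ⟨x, hx⟩ ⟨y, hy⟩ => Subtype.ext ?_⟩
  obtain ⟨i, rfl, hi⟩ := diagramLabel_eq_inl_iff.1 hx
  obtain ⟨j, rfl, hj⟩ := diagramLabel_eq_inl_iff.1 hy
  exact congrArg Sum.inl (hu hi hj)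

theorem countable_diagramLabel_fiber_inr [Countable ι] (t : ℝ) :
    Countable {x // diagramLabel p u x = .inr t} := by
  have hsub : {x | diagramLabel p u x = .inr t} ⊆
      Set.range (Sum.map id fun k : ℕ => (t, k)) := by
    intro x hx
    obtain ⟨i, rfl, -⟩ | ⟨k, rfl⟩ := diagramLabel_eq_inr hx
    exacts [⟨.inl i, rfl⟩, ⟨.inr k, rfl⟩]
  exact ((Set.countable_range _).mono hsub).to_subtype

theorem infinite_diagramLabel_fiber_inr (t : ℝ) : Infinite {x // diagramLabel p u x = .inr t} :=
  Infinite.of_injective (fun k : ℕ => ⟨.inr (t, k), rfl⟩) fun _ _ h =>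
    (Prod.mk.inj (Sum.inr_injective (congrArg Subtype.val h))).2

theorem exists_equiv_diagramLabel [Countable ι] [Countable κ] {v : κ → Option ζ}
    (hu : Relator.LeftUnique fun i z => u i = some z)
    (hv : Relator.LeftUnique fun j z => v j = some z)
    (huv : ∀ z, (∃ i, u i = some z) ↔ ∃ j, v j = some z) :
    ∃ γ : ι ⊕ (ℝ × ℕ) ≃ κ ⊕ (ℝ × ℕ), ∀ x, diagramLabel q v (γ x) = diagramLabel p u x := by
  have hfiber (l : ζ ⊕ ℝ) :
      Nonempty ({x // diagramLabel p u x = l} ≃ {y // diagramLabel q v y = l}) := by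
    obtain z | t := l
    · have hp : Subsingleton {x // diagramLabel p u x = .inl z} :=
        subsingleton_diagramLabel_fiber_inl hu z
      have hq : Subsingleton {y // diagramLabel q v y = .inl z} :=
        subsingleton_diagramLabel_fiber_inl hv z
      have hpq : Nonempty {x // diagramLabel p u x = .inl z} ↔
          Nonempty {y // diagramLabel q v y = .inl z} := by
        rw [nonempty_diagramLabel_fiber_inl, nonempty_diagramLabel_fiber_inl, huv z]
      exact ⟨equivOfSubsingletonOfSubsingleton (fun x => (hpq.1 ⟨x⟩).some)
        fun y => (hpq.2 ⟨y⟩).some⟩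
    · have := countable_diagramLabel_fiber_inr (p := p) (u := u) t
      have := countable_diagramLabel_fiber_inr (p := q) (u := v) t
      have := infinite_diagramLabel_fiber_inr (p := p) (u := u) t
      have := infinite_diagramLabel_fiber_inr (p := q) (u := v) t
      exact nonempty_equiv_of_countable
  exact ⟨Equiv.ofFiberEquiv fun l => (hfiber l).some, Equiv.ofFiberEquiv_map _⟩

end Label

theorem diagramLabel_eq_inr_mem {ζ : Type*} {u : ι → Option ζ} {x : ι ⊕ (ℝ × ℕ)} {t : ℝ}
    (h : diagramLabel p u x = .inr t)
    (hu : ∀ i, u i = none → (p i).2 - (p i).1 ∈ Set.Icc 0 (2 * δ : ℝ)) :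
    (withDiagonal p x).2 - (withDiagonal p x).1 ∈ Set.Icc 0 (2 * δ : ℝ) ∧
      ((withDiagonal p x).1 + (withDiagonal p x).2) / 2 = t := by
  obtain ⟨i, rfl, hi, ht⟩ | ⟨k, rfl⟩ := diagramLabel_eq_inr h
  · exact ⟨hu i hi, ht⟩
  · simp [withDiagonal]

theorem dist_le_of_add_eq_add {x y : ℝ × ℝ} {δ : ℝ} (hx : x.2 - x.1 ∈ Set.Icc 0 (2 * δ))
    (hy : y.2 - y.1 ∈ Set.Icc 0 (2 * δ)) (h : x.1 + x.2 = y.1 + y.2) : dist x y ≤ δ := by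
  obtain ⟨hx₀, hx₁⟩ := hx
  obtain ⟨hy₀, hy₁⟩ := hy
  rw [Prod.dist_eq, Real.dist_eq, Real.dist_eq]
  exact max_le (abs_le.2 ⟨by linarith, by linarith⟩) (abs_le.2 ⟨by linarith, by linarith⟩)

theorem exists_forall_eq_some_iff {ι κ : Type*} {R : ι → κ → Prop} (hR : Relator.RightUnique R) :
    ∃ u : ι → Option κ, ∀ i j, u i = some j ↔ R i j := by
  classical
  refine ⟨fun i => if h : ∃ j, R i j then some h.choose else none, fun i j => ?_⟩
  dsimp only
  by_cases h : ∃ j, R i j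
  · rw [dif_pos h, Option.some_inj]
    exact ⟨fun hj => hj ▸ h.choose_spec, hR h.choose_spec⟩
  · simp only [dif_neg h, reduceCtorEq, false_iff]
    exact fun hj => h ⟨j, hj⟩

theorem IsMatching.bottleneckDist_le [Countable ι] [Countable κ] (h : IsMatching δ p q R) :
    bottleneckDist p q ≤ δ := by
  obtain ⟨u, hu⟩ := exists_forall_eq_some_iff h.biUnique.2
  -- Both points of a matched pair are labelled by its member in `κ`.
  obtain ⟨v, hv⟩ := exists_forall_eq_some_iff (R := fun j j' => j = j' ∧ ∃ i, R i j)
    fun _ _ _ h h' => h.1.symm.trans h'.1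
  obtain ⟨γ, hγ⟩ := exists_equiv_diagramLabel (p := p) (q := q) (u := u) (v := v)
    (fun i i' j hi hi' => h.biUnique.1 ((hu i j).1 hi) ((hu i' j).1 hi'))
    (fun j j' z hj hj' => ((hv j z).1 hj).1.trans ((hv j' z).1 hj').1.symm)
    (by simp [hu, hv])
  refine (iInf_le _ γ).trans (iSup_le fun x => ?_)
  rw [edist_le_coe, ← NNReal.coe_le_coe, coe_nndist]
  have hx : diagramLabel q v (γ x) = diagramLabel p u x := hγ x
  rcases hl : diagramLabel p u x with j | t
  · obtain ⟨i, rfl, hi⟩ := diagramLabel_eq_inl_iff.1 hl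
    obtain ⟨j', hj', hj⟩ := diagramLabel_eq_inl_iff.1 (hx.trans hl)
    rw [hj']
    exact h.dist_le i j' (((hv j' j).1 hj).1 ▸ (hu i j).1 hi)
  · have hp := diagramLabel_eq_inr_mem hl fun i hi =>
      h.left_mem i fun j hij => by simp [(hu i j).2 hij] at hi
    have hq := diagramLabel_eq_inr_mem (hx.trans hl) fun j hj =>
      h.right_mem j fun i hij => by simp [(hv j j).2 ⟨rfl, i, hij⟩] at hj
    exact dist_le_of_add_eq_add hp.1 hq.1 (by linarith [hp.2, hq.2])

end Bottleneck

section MergeTree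

/-- An abstract merge tree on a type of leaves: `m a b` is the order at which the branches of `a`
and `b` merge, and `m a a` is the birth time of `a`. Orders decrease towards the root, which has
order `1`, so that the ultrametric inequality is reversed. -/
structure IsMergeTree {A : Type*} (m : A → A → ℕ) : Prop where
  comm : ∀ a b, m a b = m b a
  ultra : ∀ a b c, min (m a b) (m b c) ≤ m a c
  one_le : ∀ a b, 1 ≤ m a b

namespace IsMergeTree

variable {A B : Type*} {m : A → A → ℕ}

theorem symm (hm : IsMergeTree m) {k : ℕ} {a b : A} (h : k ≤ m a b) : k ≤ m b a :=
  h.trans_eq (hm.comm a b)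

theorem trans (hm : IsMergeTree m) {k : ℕ} {a b c : A} (h : k ≤ m a b) (h' : k ≤ m b c) :
    k ≤ m a c :=
  (le_min h h').trans (hm.ultra a b c)

theorem le_self (hm : IsMergeTree m) (a b : A) : m a b ≤ m a a :=
  hm.trans le_rfl (hm.symm le_rfl)

theorem onFun (hm : IsMergeTree m) (f : B → A) : IsMergeTree (m on f) where
  comm _ _ := hm.comm _ _
  ultra _ _ _ := hm.ultra _ _ _
  one_le _ _ := hm.one_le _ _

end IsMergeTree

/-- The death time of the leaf `a` when `r b a` means that `b` survives the merging of `a` and `b`: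
the highest order at which `a` merges with a leaf that survives it, or `1` if there is none. -/
noncomputable def elderDeath {A : Type*} (m : A → A → ℕ) (r : A → A → Prop) (a : A) : ℕ :=
  sSup ({1} ∪ {k | ∃ b, r b a ∧ k = m a b})

section ElderDeath

variable {A : Type*} {m : A → A → ℕ} {r : A → A → Prop} {a b : A} {k : ℕ}

theorem elderDeath_le (hk : 1 ≤ k) (h : ∀ b, r b a → m a b ≤ k) : elderDeath m r a ≤ k := by
  refine csSup_le' ?_
  rintro _ (rfl | ⟨b, hb, rfl⟩)
  exacts [hk, h b hb]

theorem bddAbove_elderDeath (hm : IsMergeTree m) :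
    BddAbove ({1} ∪ {k | ∃ b, r b a ∧ k = m a b}) := by
  refine ⟨m a a, ?_⟩
  rintro _ (rfl | ⟨b, -, rfl⟩)
  exacts [hm.one_le a a, hm.le_self a b]

theorem one_le_elderDeath (hm : IsMergeTree m) : 1 ≤ elderDeath m r a :=
  le_csSup (bddAbove_elderDeath hm) (.inl rfl)

theorem le_elderDeath (hm : IsMergeTree m) (h : r b a) : m a b ≤ elderDeath m r a :=
  le_csSup (bddAbove_elderDeath hm) (.inr ⟨b, h, rfl⟩)

theorem elderDeath_le_self (hm : IsMergeTree m) : elderDeath m r a ≤ m a a :=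
  elderDeath_le (hm.one_le a a) fun b _ => hm.le_self a b

theorem not_rel_of_elderDeath_lt (hm : IsMergeTree m) (ha : elderDeath m r a < k)
    (h : k ≤ m a b) : ¬ r b a :=
  fun hr => (ha.trans_le h).not_ge (le_elderDeath hm hr)

theorem eq_of_elderDeath_lt [Std.Trichotomous r] (hm : IsMergeTree m)
    (ha : elderDeath m r a < k) (hb : elderDeath m r b < k) (h : k ≤ m a b) : a = b :=
  Std.Trichotomous.trichotomous (r := r) a b
    (not_rel_of_elderDeath_lt hm hb (hm.symm h)) (not_rel_of_elderDeath_lt hm ha h)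

theorem exists_elderDeath_lt [IsWellFounded A r] (hm : IsMergeTree m) (hk : 1 < k)
    (ha : k ≤ m a a) : ∃ b, k ≤ m a b ∧ elderDeath m r b < k := by
  obtain ⟨b, hb, hmin⟩ := (IsWellFounded.wf (r := r)).has_min {b | k ≤ m a b} ⟨a, ha⟩
  refine ⟨b, hb, Nat.lt_of_le_pred (by omega) (elderDeath_le (Nat.le_pred_of_lt hk) fun c hc => ?_)⟩
  exact Nat.le_pred_of_lt (not_le.1 fun h => hmin c (hm.trans hb h) hc)

end ElderDeath

section Matched

variable {A B C : Type*} {m : C → C → ℕ} {f : A → C} {g : B → C}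
  {rA : A → A → Prop} {rB : B → B → Prop} {d : ℕ} {a : A} {b : B}

/-- The matching of two families `f` and `g` of leaves of one merge tree. The leaves `a` and `b`
have the same death time `d`; above `d` they survive in the same branch, or in two branches that
join at `d` and whose survivors of the other family, `b'` and `a'`, live on below `d`. -/
def Matched (m : C → C → ℕ) (f : A → C) (g : B → C) (rA : A → A → Prop) (rB : B → B → Prop)
    (d : ℕ) (a : A) (b : B) : Prop :=
  elderDeath (m on f) rA a = d ∧ elderDeath (m on g) rB b = d ∧
    (d < m (f a) (g b) ∨
      ∃ a' b', elderDeath (m on f) rA a' < d ∧ elderDeath (m on g) rB b' < d ∧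
        d ≤ m (f a) (g b) ∧ d < m (f a) (g b') ∧ d < m (f a') (g b))

theorem Matched.symm (hm : IsMergeTree m) (h : Matched m f g rA rB d a b) :
    Matched m g f rB rA d b a := by
  obtain ⟨ha, hb, h | ⟨a', b', ha', hb', hab, hab', hba'⟩⟩ := h
  · exact ⟨hb, ha, .inl (hm.symm h)⟩
  · exact ⟨hb, ha, .inr ⟨b', a', hb', ha', hm.symm hab, hm.symm hba', hm.symm hab'⟩⟩

theorem Matched.exists_not_rel [Std.Irrefl rB] (hm : IsMergeTree m)
    (h : Matched m f g rA rB d a b) : ∃ b', d < m (f a) (g b') ∧ ¬ rB b b' := by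
  obtain ⟨-, -, h | ⟨-, b', -, hb', hab, hab', -⟩⟩ := h
  · exact ⟨b, h, irrefl b⟩
  · exact ⟨b', hab', not_rel_of_elderDeath_lt (hm.onFun g) hb'
      (hm.trans (hm.symm hab'.le) hab)⟩

theorem Matched.right_unique [Std.Trichotomous rA] [Std.Trichotomous rB] (hm : IsMergeTree m)
    {b₁ b₂ : B} (h₁ : Matched m f g rA rB d a b₁) (h₂ : Matched m f g rA rB d a b₂) :
    b₁ = b₂ := by
  have unique {b₁ b₂ : B} (hb₁ : elderDeath (m on g) rB b₁ ≤ d)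
      (hb₂ : elderDeath (m on g) rB b₂ ≤ d) {c : C} (h₁ : d < m c (g b₁)) (h₂ : d < m c (g b₂)) :
      b₁ = b₂ :=
    eq_of_elderDeath_lt (hm.onFun g) (Nat.lt_succ_of_le hb₁) (Nat.lt_succ_of_le hb₂)
      (hm.trans (hm.symm h₁) h₂)
  obtain ⟨-, hb₁, h₁ | ⟨a₁, b₁', ha₁, hb₁', hab₁, hab₁', hba₁⟩⟩ := h₁ <;>
    obtain ⟨-, hb₂, h₂ | ⟨a₂, b₂', ha₂, hb₂', hab₂, hab₂', hba₂⟩⟩ := h₂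
  · exact unique hb₁.le hb₂.le h₁ h₂
  · exact absurd hb₁ (unique hb₁.le hb₂'.le h₁ hab₂' ▸ hb₂'.ne)
  · exact absurd hb₂ (unique hb₂.le hb₁'.le h₂ hab₁' ▸ hb₁'.ne)
  · have ha : a₁ = a₂ := eq_of_elderDeath_lt (hm.onFun f) ha₁ ha₂ <|
      hm.trans (hm.trans hba₁.le (hm.symm hab₁)) (hm.trans hab₂ (hm.symm hba₂.le))
    exact unique hb₁.le hb₂.le hba₁ (ha ▸ hba₂)

theorem exists_matched [IsWellOrder A rA] [IsWellOrder B rB] (hm : IsMergeTree m)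
    (h : ∀ a', ¬ rA a a' → ∃ b, elderDeath (m on f) rA a < m (f a') (g b)) :
    ∃ b, Matched m f g rA rB (elderDeath (m on f) rA a) a b := by
  generalize hd : elderDeath (m on f) rA a = d at h ⊢
  have one_le : 1 ≤ d := hd ▸ one_le_elderDeath (hm.onFun f)
  have survivor (a' : A) (ha' : ¬ rA a a') :
      ∃ b, d < m (f a') (g b) ∧ elderDeath (m on g) rB b ≤ d := by
    obtain ⟨b, hb⟩ := h a' ha'
    obtain ⟨b', hbb', hb'⟩ := exists_elderDeath_lt (r := rB) (hm.onFun g) (Nat.lt_succ_of_le one_le)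
      (hm.trans (hm.symm hb) hb)
    exact ⟨b', hm.trans hb hbb', Nat.le_of_lt_succ hb'⟩
  obtain ⟨b', hab', hb'⟩ := survivor a (irrefl a)
  obtain hb' | hb' := hb'.eq_or_lt
  · exact ⟨b', hd, hb', .inl hab'⟩
  obtain ⟨a', haa', ha'⟩ := exists_elderDeath_lt (r := rA) (hm.onFun f)
    ((one_le_elderDeath (hm.onFun g)).trans_lt hb') (hd ▸ elderDeath_le_self (hm.onFun f))
  obtain ⟨b, hba', hb⟩ := survivor a' (not_rel_of_elderDeath_lt (hm.onFun f) ha' (hm.symm haa'))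
  have hab : d ≤ m (f a) (g b) := hm.trans haa' hba'.le
  refine ⟨b, hd, hb.eq_of_not_lt fun hb => ?_, .inr ⟨a', b', ha', hb', hab, hab', hba'⟩⟩
  obtain rfl : b' = b :=
    eq_of_elderDeath_lt (hm.onFun g) hb' hb (hm.trans (hm.symm hab'.le) hab)
  obtain rfl : a = a' := eq_of_elderDeath_lt (hm.onFun f) (Nat.lt_succ_of_le hd.le)
    (ha'.trans (Nat.lt_succ_self d)) (hm.trans hab' (hm.symm hba'))
  exact ha'.ne hd

end Matched

section Interleaved

variable {A B : Type*} {mA : A → A → ℕ} {mB : B → B → ℕ} {f : A → B} {g : B → A}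
  {rA : A → A → Prop} {rB : B → B → Prop} {n : ℕ} {a : A} {b : B} {k : ℕ}

/-- Two merge trees are `n`-interleaved by `f` and `g` if these maps lower all merging orders by
at most `n`, and if going back and forth moves a leaf only along branches that leave its own branch
at most `2 * n` below its birth. -/
structure Interleaved (n : ℕ) (mA : A → A → ℕ) (mB : B → B → ℕ) (f : A → B) (g : B → A) :
    Prop where
  le_map_left : ∀ a a', mA a a' ≤ mB (f a) (f a') + n
  le_map_right : ∀ b b', mB b b' ≤ mA (g b) (g b') + n
  le_unit_left : ∀ a, mA a a ≤ mA a (g (f a)) + 2 * n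
  le_unit_right : ∀ b, mB b b ≤ mB b (f (g b)) + 2 * n

/-- An elder rule: a well-order in which leaves of higher birth time come first. -/
structure IsElderOrder {A : Type*} (m : A → A → ℕ) (r : A → A → Prop) : Prop where
  wellOrder : IsWellOrder A r
  rel_of_lt : ∀ a b, m b b < m a a → r a b

theorem IsElderOrder.le_of_not_rel {m : A → A → ℕ} {r : A → A → Prop} {a a' : A}
    (hr : IsElderOrder m r) (h : ¬ r a a') : m a a ≤ m a' a' :=
  not_lt.1 fun h' => h (hr.rel_of_lt a a' h')

theorem IsElderOrder.le_of_rel {m : A → A → ℕ} {r : A → A → Prop} {a a' : A}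
    (hr : IsElderOrder m r) (h : r a a') : m a' a' ≤ m a a :=
  have := hr.wellOrder
  hr.le_of_not_rel (asymm h)

namespace Interleaved

theorem elderDeath_le_add (h : Interleaved n mA mB f g) (hB : IsMergeTree mB) :
    elderDeath mA rA a ≤ elderDeath (mB on f) rA a + n := by
  have hf := hB.onFun f
  refine elderDeath_le ((one_le_elderDeath hf).trans (Nat.le_add_right _ _)) fun a' ha' => ?_
  exact (h.le_map_left a a').trans (Nat.add_le_add_right (le_elderDeath hf ha') n)

theorem min_le_elderDeath_add (h : Interleaved n mA mB f g) (hA : IsMergeTree mA)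
    (hrA : IsElderOrder mA rA) :
    min (mA a a) (elderDeath (mB on f) rA a + n) ≤ elderDeath mA rA a + 2 * n := by
  refine min_le_iff.2 (or_iff_not_imp_left.2 fun hlong => ?_)
  suffices elderDeath (mB on f) rA a ≤ elderDeath mA rA a + n by omega
  refine elderDeath_le ((one_le_elderDeath hA).trans (Nat.le_add_right _ _)) fun a' ha' => ?_
  have hback : min (mA a (g (f a))) (mA (g (f a)) (g (f a'))) ≤ mA a (g (f a')) := hA.ultra _ _ _
  have hmerge : min (mA a (g (f a'))) (mA (g (f a')) a') ≤ mA a a' := hA.ultra _ _ _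
  have hcomm : mA (g (f a')) a' = mA a' (g (f a')) := hA.comm _ _
  have hbirth := hrA.le_of_rel ha'
  have hdeath := le_elderDeath hA ha'
  have hf : mB (f a) (f a') ≤ mA (g (f a)) (g (f a')) + n := h.le_map_right _ _
  have hu := h.le_unit_left a
  have hu' := h.le_unit_left a'
  change mB (f a) (f a') ≤ _
  omega

theorem birth_right_le_of_elderDeath_lt (h : Interleaved n mA mB f g) (hB : IsMergeTree mB)
    (hrA : IsElderOrder mA rA) (ha : elderDeath (mB on f) rA a < k) (hk : k ≤ mB (f a) b)
    (hb : k + 2 * n ≤ mB b b) : mB b b ≤ mA a a + n := by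
  have hback : k ≤ mB b (f (g b)) := by have := h.le_unit_right b; omega
  have hsurvives : ¬ rA (g b) a := not_rel_of_elderDeath_lt (hB.onFun f) ha (hB.trans hk hback)
  exact (h.le_map_right b b).trans (Nat.add_le_add_right (hrA.le_of_not_rel hsurvives) n)

theorem birth_left_le_of_elderDeath_lt (h : Interleaved n mA mB f g) (hB : IsMergeTree mB)
    (hrB : IsElderOrder mB rB) (hb : elderDeath mB rB b < mB b (f a)) : mA a a ≤ mB b b + n :=
  (h.le_map_left a a).trans
    (Nat.add_le_add_right (hrB.le_of_not_rel (not_rel_of_elderDeath_lt hB hb le_rfl)) n)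

end Interleaved

/-- The partial bijection of the leaves of two `n`-interleaved trees: the leaves of the first tree
are moved to the second tree by `f` and matched there, up to those that die within `n` of their
birth. -/
def Partner (n : ℕ) (mA : A → A → ℕ) (mB : B → B → ℕ) (f : A → B) (rA : A → A → Prop)
    (rB : B → B → Prop) (a : A) (b : B) : Prop :=
  ∃ d, Matched mB f id rA rB d a b ∧ d + n < mA a a

theorem Partner.biUnique [Std.Trichotomous rA] [Std.Trichotomous rB] (hB : IsMergeTree mB) :
    Relator.BiUnique (Partner n mA mB f rA rB) := by
  constructor
  · rintro a₁ a₂ b ⟨d, h₁, -⟩ ⟨_, h₂, -⟩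
    obtain rfl := h₁.2.1.symm.trans h₂.2.1
    exact (h₁.symm hB).right_unique hB (h₂.symm hB)
  · rintro a b₁ b₂ ⟨d, h₁, -⟩ ⟨_, h₂, -⟩
    obtain rfl := h₁.1.symm.trans h₂.1
    exact h₁.right_unique hB h₂

namespace Interleaved

theorem death_close (h : Interleaved n mA mB f g) (hA : IsMergeTree mA) (hB : IsMergeTree mB)
    (hrA : IsElderOrder mA rA) (hab : Partner n mA mB f rA rB a b) :
    elderDeath mA rA a ≤ elderDeath mB rB b + n ∧ elderDeath mB rB b ≤ elderDeath mA rA a + n := by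
  obtain ⟨_, ⟨rfl, hb, -⟩, hlong⟩ := hab
  change elderDeath mB rB b = _ at hb
  have hle := h.elderDeath_le_add hB (rA := rA) (a := a)
  have hge := h.min_le_elderDeath_add hA hrA (a := a)
  omega

theorem birth_close (h : Interleaved n mA mB f g) (hB : IsMergeTree mB)
    (hrA : IsElderOrder mA rA) (hrB : IsElderOrder mB rB) (hab : Partner n mA mB f rA rB a b) :
    mA a a ≤ mB b b + n ∧ mB b b ≤ mA a a + n := by
  have := hrA.wellOrder
  have := hrB.wellOrder
  obtain ⟨d, hab, hlong⟩ := hab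
  obtain ⟨b', hab', hb'⟩ := hab.exists_not_rel hB
  obtain ⟨a', hba', ha'⟩ := (hab.symm hB).exists_not_rel hB
  have hbirth : mB b b ≤ mB b' b' := hrB.le_of_not_rel hb'
  refine ⟨(hrA.le_of_not_rel ha').trans (h.birth_left_le_of_elderDeath_lt hB hrB ?_), ?_⟩
  · exact hab.2.1.trans_lt hba'
  · by_contra! hlt
    have := h.birth_right_le_of_elderDeath_lt (b := b') hB hrA (Nat.lt_succ_of_le hab.1.le) hab'
      (by omega)
    omega

theorem exists_partner_right (h : Interleaved n mA mB f g) (hA : IsMergeTree mA)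
    (hB : IsMergeTree mB) (hrA : IsElderOrder mA rA) (hrB : IsElderOrder mB rB)
    (hlong : elderDeath mA rA a + 2 * n < mA a a) : ∃ b, Partner n mA mB f rA rB a b := by
  have := hrA.wellOrder
  have := hrB.wellOrder
  have hlong' : elderDeath (mB on f) rA a + n < mA a a := by
    have := h.min_le_elderDeath_add hA hrA (a := a); omega
  have hcover (a' : A) (ha' : ¬ rA a a') : ∃ b, elderDeath (mB on f) rA a < mB (f a') b := by
    have := hrA.le_of_not_rel ha'
    have := h.le_map_left a' a'
    exact ⟨f a', by omega⟩
  obtain ⟨b, hab⟩ := exists_matched (g := id) (rB := rB) hB hcover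
  exact ⟨b, _, hab, hlong'⟩

theorem exists_partner_left (h : Interleaved n mA mB f g) (hB : IsMergeTree mB)
    (hrA : IsElderOrder mA rA) (hrB : IsElderOrder mB rB)
    (hlong : elderDeath mB rB b + 2 * n < mB b b) : ∃ a, Partner n mA mB f rA rB a b := by
  have := hrA.wellOrder
  have := hrB.wellOrder
  have hcover (b' : B) (hb' : ¬ rB b b') : ∃ a, elderDeath mB rB b < mB b' (f a) := by
    have := hrB.le_of_not_rel hb'
    have := h.le_unit_right b'
    exact ⟨g b', by omega⟩
  obtain ⟨a, hba⟩ : ∃ a, Matched mB id f rB rA (elderDeath mB rB b) b a := exists_matched hB hcover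
  have hab := hba.symm hB
  obtain ⟨b', hab', hb'⟩ := hab.exists_not_rel hB
  have hbirth : mB b b ≤ mB b' b' := hrB.le_of_not_rel hb'
  have := h.birth_right_le_of_elderDeath_lt (b := b') hB hrA (Nat.lt_succ_of_le hab.1.le) hab'
    (by omega)
  exact ⟨a, _, hab, by omega⟩

end Interleaved

theorem dist_natCast_le {k l n : ℕ} (h : k ≤ l + n) (h' : l ≤ k + n) : dist (k : ℝ) l ≤ n :=
  abs_sub_le_iff.2 ⟨sub_le_iff_le_add'.2 (mod_cast h), sub_le_iff_le_add'.2 (mod_cast h')⟩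

/-- The point `(death, birth)` of the leaf `a` in the persistence diagram of a merge tree. -/
noncomputable def elderPoint {A : Type*} (m : A → A → ℕ) (r : A → A → Prop) (a : A) : ℝ × ℝ :=
  (elderDeath m r a, m a a)

theorem elderPoint_mem_Icc {A : Type*} {m : A → A → ℕ} {r : A → A → Prop} {a : A}
    (hm : IsMergeTree m) (h : m a a ≤ elderDeath m r a + 2 * n) :
    (elderPoint m r a).2 - (elderPoint m r a).1 ∈ Set.Icc 0 (2 * (n : ℝ≥0) : ℝ) := by
  have hle : (elderDeath m r a : ℝ) ≤ m a a := mod_cast elderDeath_le_self hm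
  have hge : (m a a : ℝ) ≤ elderDeath m r a + 2 * n := mod_cast h
  rw [NNReal.coe_natCast]
  exact ⟨sub_nonneg.2 hle, sub_le_iff_le_add'.2 hge⟩

namespace Interleaved

theorem isMatching {A B : Type u} {mA : A → A → ℕ} {mB : B → B → ℕ} {f : A → B} {g : B → A}
    {rA : A → A → Prop} {rB : B → B → Prop} (h : Interleaved n mA mB f g) (hA : IsMergeTree mA)
    (hB : IsMergeTree mB) (hrA : IsElderOrder mA rA) (hrB : IsElderOrder mB rB) :
    IsMatching n (elderPoint mA rA) (elderPoint mB rB) (Partner n mA mB f rA rB) where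
  biUnique :=
    have := hrA.wellOrder
    have := hrB.wellOrder
    Partner.biUnique hB
  dist_le a b hab := by
    obtain ⟨hd, hd'⟩ := h.death_close hA hB hrA hab
    obtain ⟨hb, hb'⟩ := h.birth_close hB hrA hrB hab
    exact max_le (dist_natCast_le hd hd') (dist_natCast_le hb hb')
  left_mem a ha := elderPoint_mem_Icc hA <| not_lt.1 fun hlong =>
    (h.exists_partner_right hA hB hrA hrB hlong).elim ha
  right_mem b hb := elderPoint_mem_Icc hB <| not_lt.1 fun hlong =>
    (h.exists_partner_left hB hrA hrB hlong).elim hb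

end Interleaved

end Interleaved

end MergeTree

section Linked

variable {α : Type u} [DecidableEq α] {G G' : Network α} {m k : ℕ} {K L M V : Finset α}

/-- Two cliques with at least `m` vertices each that share at least `m - 1` of them. -/
structure Overlap (G : Network α) (m : ℕ) (K L : Finset α) : Prop where
  isClique_left : G.spanningCoe.IsClique K
  isClique_right : G.spanningCoe.IsClique L
  le_card_left : m ≤ K.card
  le_card_right : m ≤ L.card
  le_card_inter : m ≤ (K ∩ L).card + 1

/-- `K` and `L` are cliques, of any sizes, whose `m`-cliques lie in the same `m`-community. -/
def Linked (G : Network α) (m : ℕ) : Finset α → Finset α → Prop :=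
  Relation.TransGen (Overlap G m)

theorem Overlap.symm (h : Overlap G m K L) : Overlap G m L K :=
  ⟨h.isClique_right, h.isClique_left, h.le_card_right, h.le_card_left,
    Finset.inter_comm K L ▸ h.le_card_inter⟩

theorem Overlap.of_le (hkm : k ≤ m) (h : Overlap G m K L) : Overlap G k K L :=
  ⟨h.isClique_left, h.isClique_right, hkm.trans h.le_card_left, hkm.trans h.le_card_right,
    hkm.trans h.le_card_inter⟩

theorem overlap_of_subset (hL : G.spanningCoe.IsClique L) (hKL : K ⊆ L) (hK : m ≤ K.card) :
    Overlap G m K L where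
  isClique_left := hL.subset (Finset.coe_subset.2 hKL)
  isClique_right := hL
  le_card_left := hK
  le_card_right := hK.trans (Finset.card_le_card hKL)
  le_card_inter := by rw [Finset.inter_eq_left.2 hKL]; omega

theorem Linked.symm (h : Linked G m K L) : Linked G m L K :=
  Relation.TransGen.mono (fun _ _ => Overlap.symm) _ _ h.swap

theorem Linked.trans (h : Linked G m K L) (h' : Linked G m L M) : Linked G m K M :=
  Relation.TransGen.trans h h'

theorem Linked.of_le (hkm : k ≤ m) (h : Linked G m K L) : Linked G k K L :=
  Relation.TransGen.mono (fun _ _ => Overlap.of_le hkm) _ _ h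

theorem linked_of_subset (hL : G.spanningCoe.IsClique L) (hKL : K ⊆ L) (hK : m ≤ K.card) :
    Linked G m K L :=
  .single (overlap_of_subset hL hKL hK)

theorem Linked.isClique_left (h : Linked G m K L) : G.spanningCoe.IsClique K :=
  have ⟨_, h, _⟩ := Relation.TransGen.head'_iff.1 h
  h.isClique_left

theorem Linked.le_card_left (h : Linked G m K L) : m ≤ K.card :=
  have ⟨_, h, _⟩ := Relation.TransGen.head'_iff.1 h
  h.le_card_left

theorem isClique_sdiff (hV : (G.spanningCoe \ G'.spanningCoe).IsVertexCover V)
    (hK : G.spanningCoe.IsClique K) : G'.spanningCoe.IsClique (K \ V : Finset α) := by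
  intro v hv w hw hne
  rw [Finset.mem_coe, Finset.mem_sdiff] at hv hw
  by_contra h
  exact (hV ⟨hK hv.1 hw.1 hne, h⟩).elim hv.2 hw.2

theorem Overlap.sdiff (hV : (G.spanningCoe \ G'.spanningCoe).IsVertexCover V)
    (h : Overlap G (m + V.card) K L) : Overlap G' m (K \ V) (L \ V) where
  isClique_left := isClique_sdiff hV h.isClique_left
  isClique_right := isClique_sdiff hV h.isClique_right
  le_card_left := (Nat.le_sub_of_add_le h.le_card_left).trans (Finset.le_card_sdiff V K)
  le_card_right := (Nat.le_sub_of_add_le h.le_card_right).trans (Finset.le_card_sdiff V L)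
  le_card_inter := by
    have hcard := Finset.le_card_sdiff V (K ∩ L)
    have hinter := h.le_card_inter
    rw [← Finset.inf_eq_inter, ← inf_sdiff, Finset.inf_eq_inter]
    omega

theorem Linked.sdiff (hV : (G.spanningCoe \ G'.spanningCoe).IsVertexCover V)
    (h : Linked G (m + V.card) K L) : Linked G' m (K \ V) (L \ V) :=
  Relation.TransGen.lift (· \ V) (fun _ _ => Overlap.sdiff hV) _ _ h

end Linked

section Reachable

variable {α : Type u} {G : Network α} {m : ℕ} {K L : Finset α}

theorem isKClique_of_subset (hm : 2 ≤ m) (hK : G.spanningCoe.IsClique K) (hLK : L ⊆ K)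
    (hL : L.card = m) : IsKClique G m L := by
  have hcl : G.spanningCoe.IsClique L := hK.subset (Finset.coe_subset.2 hLK)
  refine ⟨fun v hv => ?_, hcl, hL⟩
  obtain ⟨w, hw, hne⟩ := Finset.exists_mem_ne (by omega : 1 < L.card) v
  exact G.edge_vert (hcl hv hw hne.symm)

variable {S T : {K : Finset α // IsKClique G m K}}

theorem percolationGraph_adj [DecidableEq α] :
    (percolationGraph G m).Adj S T ↔ (S.1 ∩ T.1).card + 1 = m := by
  rw [← Set.ncard_coe_finset, Finset.coe_inter]
  rfl

theorem reachable_of_le_card_inter [DecidableEq α] (h : m ≤ (S.1 ∩ T.1).card + 1) :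
    (percolationGraph G m).Reachable S T := by
  obtain h | h := h.eq_or_lt
  · exact (percolationGraph_adj.2 h.symm).reachable
  · have hle : m ≤ (S.1 ∩ T.1).card := Nat.le_of_lt_succ h
    have hS : S.1 ∩ T.1 = S.1 :=
      Finset.eq_of_subset_of_card_le Finset.inter_subset_left (S.2.2.card_eq.trans_le hle)
    have hT : S.1 ∩ T.1 = T.1 :=
      Finset.eq_of_subset_of_card_le Finset.inter_subset_right (T.2.2.card_eq.trans_le hle)
    rw [Subtype.ext (hS.symm.trans hT)]

theorem reachable_of_subset_isClique (hm : 2 ≤ m) (hK : G.spanningCoe.IsClique K) (hS : S.1 ⊆ K)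
    (hT : T.1 ⊆ K) : (percolationGraph G m).Reachable S T := by
  classical
  induction hn : (S.1 \ T.1).card generalizing S with
  | zero =>
    refine reachable_of_le_card_inter ?_
    have := Finset.card_sdiff_add_card_inter S.1 T.1
    have := S.2.2.card_eq
    omega
  | succ n ih =>
    have hcard : (S.1 \ T.1).card = (T.1 \ S.1).card :=
      Finset.card_sdiff_comm (S.2.2.card_eq.trans T.2.2.card_eq.symm)
    obtain ⟨v, hv⟩ := Finset.card_pos.1 (by omega : 0 < (S.1 \ T.1).card)
    obtain ⟨w, hw⟩ := Finset.card_pos.1 (by omega : 0 < (T.1 \ S.1).card)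
    have hvS := (Finset.mem_sdiff.1 hv).1
    obtain ⟨hwT, hwS⟩ := Finset.mem_sdiff.1 hw
    have hexch : insert w (S.1.erase v) ⊆ K :=
      Finset.insert_subset (hT hwT) ((Finset.erase_subset v S.1).trans hS)
    have hexchcard : (insert w (S.1.erase v)).card = m := by
      rw [Finset.card_insert_of_notMem (fun h => hwS (Finset.mem_of_mem_erase h)),
        Finset.card_erase_add_one hvS, S.2.2.card_eq]
    let S' : {K : Finset α // IsKClique G m K} :=
      ⟨insert w (S.1.erase v), isKClique_of_subset hm hK hexch hexchcard⟩
    have hSS' : (percolationGraph G m).Reachable S S' := by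
      refine reachable_of_le_card_inter ?_
      rw [Finset.inter_insert_of_notMem hwS, Finset.inter_eq_right.2 (Finset.erase_subset v S.1),
        Finset.card_erase_add_one hvS, S.2.2.card_eq]
    refine hSS'.trans (ih (S := S') hexch ?_)
    rw [Finset.insert_sdiff_of_mem _ hwT, Finset.erase_sdiff_comm, Finset.card_erase_of_mem hv, hn,
      Nat.add_sub_cancel]

theorem Overlap.reachable [DecidableEq α] (hm : 2 ≤ m) (h : Overlap G m K L) (hS : S.1 ⊆ K)
    (hT : T.1 ⊆ L) : (percolationGraph G m).Reachable S T := by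
  obtain ⟨I, hI, hIcard⟩ := Finset.exists_subset_card_eq (Nat.sub_le_of_le_add h.le_card_inter)
  have hIm : I.card ≤ m := hIcard.trans_le (Nat.sub_le m 1)
  obtain ⟨S₀, hIS, hSK, hScard⟩ := Finset.exists_subsuperset_card_eq
    (hI.trans Finset.inter_subset_left) hIm h.le_card_left
  obtain ⟨T₀, hIT, hTL, hTcard⟩ := Finset.exists_subsuperset_card_eq
    (hI.trans Finset.inter_subset_right) hIm h.le_card_right
  let S' : {K : Finset α // IsKClique G m K} :=
    ⟨S₀, isKClique_of_subset hm h.isClique_left hSK hScard⟩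
  let T' : {K : Finset α // IsKClique G m K} :=
    ⟨T₀, isKClique_of_subset hm h.isClique_right hTL hTcard⟩
  have hcross : (percolationGraph G m).Reachable S' T' := by
    have hcard : I.card ≤ (S'.1 ∩ T'.1).card :=
      Finset.card_le_card (Finset.subset_inter hIS hIT)
    exact reachable_of_le_card_inter (by omega)
  exact (reachable_of_subset_isClique hm h.isClique_left hS hSK).trans
    (hcross.trans (reachable_of_subset_isClique hm h.isClique_right hTL hT))

theorem Linked.reachable [DecidableEq α] (hm : 2 ≤ m) (h : Linked G m K L) (hS : S.1 ⊆ K)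
    (hT : T.1 ⊆ L) : (percolationGraph G m).Reachable S T := by
  induction h generalizing T with
  | single h => exact h.reachable hm hS hT
  | tail _ h ih =>
    obtain ⟨M, hM, hMcard⟩ := Finset.exists_subset_card_eq h.le_card_left
    let M' : {K : Finset α // IsKClique G m K} :=
      ⟨M, isKClique_of_subset hm h.isClique_left hM hMcard⟩
    exact (ih (T := M') hM).trans (h.reachable hm hM hT)

theorem reachable_iff_linked [DecidableEq α] (hm : 2 ≤ m) :
    (percolationGraph G m).Reachable S T ↔ Linked G m S.1 T.1 := by
  refine ⟨fun h => ?_, fun h => h.reachable hm subset_rfl subset_rfl⟩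
  rw [SimpleGraph.reachable_iff_reflTransGen] at h
  induction h with
  | refl => exact linked_of_subset S.2.2.isClique subset_rfl S.2.2.card_eq.ge
  | @tail T U _ hTU ih =>
    exact ih.trans (.single ⟨T.2.2.isClique, U.2.2.isClique, T.2.2.card_eq.ge,
      U.2.2.card_eq.ge, (percolationGraph_adj.1 hTU).ge⟩)

end Reachable

section Tree

variable {α : Type u} {G : Network α}

namespace Community

variable {C D E : Community G} {K L : Finset α} {m : ℕ}

theorem isKClique (hK : K ∈ C.cliques) : IsKClique G C.order K := by
  cases C with
  | whole => exact hK
  | ofComponent k hk c =>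
    obtain ⟨S, -, rfl⟩ := hK
    exact S.2

theorem card_eq (hK : K ∈ C.cliques) : K.card = C.order :=
  (isKClique hK).2.card_eq

theorem nonempty_cliques (hC : 2 ≤ C.order) : C.cliques.Nonempty := by
  cases C with
  | whole => exact absurd hC (not_le.2 one_lt_two)
  | ofComponent k hk c => exact c.nonempty_supp.image _

theorem eq_whole (hC : C.order < 2) : C = whole := by
  cases C with
  | whole => rfl
  | ofComponent k hk c => exact absurd hk hC.not_ge

theorem eq_of_mem_cliques (h : C.order = D.order) (hC : 2 ≤ C.order) (hKC : K ∈ C.cliques)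
    (hKD : K ∈ D.cliques) : C = D := by
  cases C with
  | whole => exact absurd hC (not_le.2 one_lt_two)
  | ofComponent k hk c =>
    cases D with
    | whole => exact absurd (h ▸ hC) (not_le.2 one_lt_two)
    | ofComponent l hl d =>
      obtain rfl : k = l := h
      obtain ⟨S, hS, rfl⟩ := hKC
      obtain ⟨T, hT, hTS⟩ := hKD
      obtain rfl := Subtype.ext hTS
      rw [← hS, ← hT]

theorem nested_refl (C : Community G) : C.Nested C := by
  refine ⟨le_rfl, fun K hK L hL hLcard => ?_⟩
  rwa [Finset.eq_of_subset_of_card_le hL ((card_eq hK).trans hLcard.symm).le]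

theorem nested_whole (C : Community G) : C.Nested whole := by
  refine ⟨?_, fun K hK L hL hLcard => ?_⟩
  · cases C with
    | whole => exact le_rfl
    | ofComponent k hk c => exact one_le_two.trans hk
  · have hLK := Finset.coe_subset.2 hL
    exact ⟨hLK.trans (isKClique hK).1, (isKClique hK).2.isClique.subset hLK, hLcard⟩

theorem Nested.trans (h : C.Nested D) (h' : D.Nested E) : C.Nested E := by
  refine ⟨h'.1.trans h.1, fun K hK L hL hLcard => ?_⟩
  obtain ⟨M, hLM, hMK, hM⟩ := Finset.exists_subsuperset_card_eq hL (hLcard.trans_le h'.1)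
    (h.1.trans_eq (card_eq hK).symm)
  exact h'.2 M (h.2 K hK M hMK hM) L hLM hLcard

theorem Nested.eq (h : C.Nested D) (horder : C.order ≤ D.order) : C = D := by
  have horder := horder.antisymm h.1
  by_cases hC : 2 ≤ C.order
  · obtain ⟨K, hK⟩ := nonempty_cliques hC
    exact eq_of_mem_cliques horder hC hK
      (h.2 K hK K subset_rfl ((card_eq hK).trans horder))
  · exact (eq_whole (not_le.1 hC)).trans (eq_whole (horder ▸ not_le.1 hC)).symm

variable [DecidableEq α]

theorem linked_of_mem_cliques (hC : 2 ≤ C.order) (hK : K ∈ C.cliques) (hL : L ∈ C.cliques) :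
    Linked G C.order K L := by
  cases C with
  | whole => exact absurd hC (not_le.2 one_lt_two)
  | ofComponent k hk c =>
    obtain ⟨S, hS, rfl⟩ := hK
    obtain ⟨T, hT, rfl⟩ := hL
    exact (reachable_iff_linked hk).1 (SimpleGraph.ConnectedComponent.exact (hS.trans hT.symm))

theorem mem_cliques_of_linked (hD : 2 ≤ D.order) (hK : K.card = D.order) (hL : L ∈ D.cliques)
    (h : Linked G D.order K L) : K ∈ D.cliques := by
  have hK := isKClique_of_subset hD h.isClique_left subset_rfl hK
  cases D with
  | whole => exact hK
  | ofComponent k hk c =>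
    obtain ⟨T, hT, rfl⟩ := hL
    exact ⟨⟨K, hK⟩, (SimpleGraph.ConnectedComponent.sound ((reachable_iff_linked hk).2 h)).trans hT,
      rfl⟩

theorem exists_linked (hm : 2 ≤ m) (hK : G.spanningCoe.IsClique K) (hcard : m ≤ K.card) :
    ∃ D : Community G, D.order = m ∧ ∃ L ∈ D.cliques, Linked G m K L := by
  obtain ⟨L, hLK, hL⟩ := Finset.exists_subset_card_eq hcard
  let S : {K : Finset α // IsKClique G m K} := ⟨L, isKClique_of_subset hm hK hLK hL⟩
  exact ⟨ofComponent m hm ((percolationGraph G m).connectedComponentMk S), rfl, L,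
    ⟨S, rfl, rfl⟩, (linked_of_subset hK hLK hL.ge).symm⟩

theorem nested_iff_linked (hD : 2 ≤ D.order) :
    C.Nested D ↔ ∃ K ∈ C.cliques, ∃ L ∈ D.cliques, Linked G D.order K L := by
  constructor
  · intro h
    obtain ⟨K, hK⟩ := nonempty_cliques (hD.trans h.1)
    obtain ⟨L, hLK, hL⟩ := Finset.exists_subset_card_eq (h.1.trans_eq (card_eq hK).symm)
    exact ⟨K, hK, L, h.2 K hK L hLK hL, (linked_of_subset (isKClique hK).2.isClique hLK hL.ge).symm⟩
  · rintro ⟨K, hK, L, hL, h⟩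
    have horder : D.order ≤ C.order := h.le_card_left.trans_eq (card_eq hK)
    refine ⟨horder, fun K' hK' L' hL' hL'card => mem_cliques_of_linked hD hL'card hL ?_⟩
    have hK'K : Linked G D.order K' K :=
      (linked_of_mem_cliques (hD.trans horder) hK' hK).of_le horder
    exact (linked_of_subset (isKClique hK').2.isClique hL' hL'card.ge).trans (hK'K.trans h)

end Community

section Finite

theorem finite_community (hG : G.verts.Finite) : Finite (Community G) := by
  have hfinsets : {K : Finset α | (K : Set α) ⊆ G.verts}.Finite :=
    hG.finite_subsets.preimage Finset.coe_injective.injOn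
  have hcommunities (K : Finset α) : {C : Community G | 2 ≤ C.order ∧ K ∈ C.cliques}.Finite :=
    Set.Subsingleton.finite fun C hC D hD => Community.eq_of_mem_cliques
      ((Community.card_eq hC.2).symm.trans (Community.card_eq hD.2)) hC.1 hC.2 hD.2
  refine Set.finite_univ_iff.1 (((Set.finite_singleton .whole).union
    (hfinsets.biUnion fun K _ => hcommunities K)).subset fun C _ => ?_)
  obtain hC | hC := lt_or_ge C.order 2
  · exact .inl (Community.eq_whole hC)
  · obtain ⟨K, hK⟩ := Community.nonempty_cliques hC
    exact .inr (Set.mem_biUnion (Community.isKClique hK).1 ⟨hC, hK⟩)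

theorem finite_leaf (hG : G.verts.Finite) : Finite (Leaf G) :=
  have := finite_community hG
  Subtype.finite

theorem exists_leaf_nested (hG : G.verts.Finite) (C : Community G) :
    ∃ a : Leaf G, a.1.Nested C := by
  have := finite_community hG
  obtain ⟨D, hD, hmax⟩ := (Set.toFinite {D : Community G | D.Nested C}).exists_maximalFor
    Community.order _ ⟨C, C.nested_refl⟩
  exact ⟨⟨D, fun E hE => hE.eq (hmax (hE.trans hD) hE.1)⟩, hD⟩

end Finite

section MergeOrder

variable {a b : Leaf G} {m : ℕ}

theorem bddAbove_mergeOrder (a b : Leaf G) :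
    BddAbove {m | ∃ D : Community G, a.1.Nested D ∧ b.1.Nested D ∧ D.order = m} := by
  refine ⟨birth a, ?_⟩
  rintro m ⟨D, hD, -, rfl⟩
  exact hD.1

theorem order_le_mergeOrder {D : Community G} (ha : a.1.Nested D) (hb : b.1.Nested D) :
    D.order ≤ mergeOrder a b :=
  le_csSup (bddAbove_mergeOrder a b) ⟨D, ha, hb, rfl⟩

theorem one_le_mergeOrder (a b : Leaf G) : 1 ≤ mergeOrder a b :=
  order_le_mergeOrder a.1.nested_whole b.1.nested_whole

theorem exists_order_eq_mergeOrder (a b : Leaf G) :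
    ∃ D : Community G, a.1.Nested D ∧ b.1.Nested D ∧ D.order = mergeOrder a b :=
  Nat.sSup_mem (s := {m | ∃ D : Community G, a.1.Nested D ∧ b.1.Nested D ∧ D.order = m})
    ⟨1, .whole, a.1.nested_whole, b.1.nested_whole, rfl⟩ (bddAbove_mergeOrder a b)

theorem mergeOrder_self (a : Leaf G) : mergeOrder a a = birth a := by
  obtain ⟨D, hD, -, hmerge⟩ := exists_order_eq_mergeOrder a a
  exact (hmerge ▸ hD.1).antisymm (order_le_mergeOrder a.1.nested_refl a.1.nested_refl)

theorem le_mergeOrder_iff_linked [DecidableEq α] (hm : 2 ≤ m) :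
    m ≤ mergeOrder a b ↔ ∃ K ∈ a.1.cliques, ∃ L ∈ b.1.cliques, Linked G m K L := by
  constructor
  · intro h
    obtain ⟨D, ha, hb, hD⟩ := exists_order_eq_mergeOrder a b
    have hmD : m ≤ D.order := h.trans_eq hD.symm
    obtain ⟨K, hK, M, hM, hKM⟩ := (Community.nested_iff_linked (hm.trans hmD)).1 ha
    obtain ⟨L, hL, N, hN, hLN⟩ := (Community.nested_iff_linked (hm.trans hmD)).1 hb
    have hMN := Community.linked_of_mem_cliques (hm.trans hmD) hM hN
    exact ⟨K, hK, L, hL, (hKM.trans (hMN.trans hLN.symm)).of_le hmD⟩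
  · rintro ⟨K, hK, L, hL, h⟩
    obtain ⟨D, rfl, M, hM, hLM⟩ :=
      Community.exists_linked hm h.symm.isClique_left h.symm.le_card_left
    exact order_le_mergeOrder ((Community.nested_iff_linked hm).2 ⟨K, hK, M, hM, h.trans hLM⟩)
      ((Community.nested_iff_linked hm).2 ⟨L, hL, M, hM, hLM⟩)

theorem isMergeTree_mergeOrder (G : Network α) : IsMergeTree (mergeOrder (G := G)) where
  comm a b := by simp only [mergeOrder, and_left_comm]
  ultra a b c := by
    classical
    obtain h | h := lt_or_ge (min (mergeOrder a b) (mergeOrder b c)) 2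
    · exact (Nat.le_of_lt_succ h).trans (one_le_mergeOrder a c)
    · obtain ⟨K, hK, L, hL, hKL⟩ := (le_mergeOrder_iff_linked h).1 (min_le_left _ _)
      obtain ⟨M, hM, N, hN, hMN⟩ := (le_mergeOrder_iff_linked h).1 (min_le_right _ _)
      have horder : min (mergeOrder a b) (mergeOrder b c) ≤ b.1.order :=
        hKL.symm.le_card_left.trans_eq (Community.card_eq hL)
      have hLM := (Community.linked_of_mem_cliques (h.trans horder) hL hM).of_le horder
      exact (le_mergeOrder_iff_linked h).2 ⟨K, hK, N, hN, hKL.trans (hLM.trans hMN)⟩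
  one_le := one_le_mergeOrder

theorem IsElderRule.wellFounded [Finite (Leaf G)] {elder : Leaf G → Leaf G → Prop}
    (h : IsElderRule G elder) : WellFounded elder :=
  have := h.strictTotal
  Finite.wellFounded_of_trans_of_irrefl elder

theorem IsElderRule.isElderOrder {elder : Leaf G → Leaf G → Prop} (h : IsElderRule G elder)
    (hwf : WellFounded elder) : IsElderOrder mergeOrder elder where
  wellOrder := { h.strictTotal with wf := hwf }
  rel_of_lt a b hab := h.of_birth_lt a b (by rwa [mergeOrder_self, mergeOrder_self] at hab)

theorem diagramPoint_eq_elderPoint (G : Network α) (elder : Leaf G → Leaf G → Prop) :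
    diagramPoint G elder = elderPoint mergeOrder elder := by
  funext a
  rw [elderPoint, mergeOrder_self]
  rfl

end MergeOrder

section Shadows

variable [DecidableEq α] {G' : Network α} {V : Finset α} {a a' : Leaf G} {b b' : Leaf G'}

/-- What is left of the branch of `a` when the vertices of `V` are deleted from its cliques lies in
the branch of `b`. Deleting `V` makes cliques smaller by up to `V.card`, so this concerns only the
part of the branch at orders up to `birth a - V.card`. -/
def Shadows (V : Finset α) (a : Leaf G) (b : Leaf G') : Prop :=
  ∀ m, 2 ≤ m → m + V.card ≤ birth a → ∀ K ∈ a.1.cliques, ∃ L ∈ b.1.cliques, Linked G' m (K \ V) L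

theorem exists_shadows (hV : (G.spanningCoe \ G'.spanningCoe).IsVertexCover V)
    (hG' : ∀ C : Community G', ∃ b : Leaf G', b.1.Nested C) (a : Leaf G) :
    ∃ b : Leaf G', Shadows V a b := by
  obtain h | h := lt_or_ge (birth a - V.card) 2
  · obtain ⟨b, -⟩ := hG' .whole
    exact ⟨b, fun m hm hma => absurd hm (by omega)⟩
  obtain ⟨K, hK⟩ := Community.nonempty_cliques (C := a.1) (h.trans (Nat.sub_le _ _))
  have hcard : birth a - V.card ≤ (K \ V).card := by
    rw [birth, ← Community.card_eq hK]
    exact Finset.le_card_sdiff V K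
  obtain ⟨D, hD, M, hM, hKM⟩ := Community.exists_linked h
    (isClique_sdiff hV (Community.isKClique hK).2.isClique) hcard
  obtain ⟨b, hb⟩ := hG' D
  obtain ⟨L, hL, N, hN, hLN⟩ := (Community.nested_iff_linked (h.trans_eq hD.symm)).1 hb
  have hMN := Community.linked_of_mem_cliques (h.trans_eq hD.symm) hM hN
  rw [hD] at hLN hMN
  refine ⟨b, fun m _ hma K' hK' => ⟨L, hL, ?_⟩⟩
  have hK'K : Linked G' m (K' \ V) (K \ V) :=
    ((Community.linked_of_mem_cliques (h.trans (Nat.sub_le _ _)) hK' hK).of_le hma).sdiff hV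
  exact hK'K.trans ((hKM.trans (hMN.trans hLN.symm)).of_le (Nat.le_sub_of_add_le hma))

theorem Shadows.mergeOrder_le (hV : (G.spanningCoe \ G'.spanningCoe).IsVertexCover V)
    (h : Shadows V a b) (h' : Shadows V a' b') :
    mergeOrder a a' ≤ mergeOrder b b' + V.card := by
  rw [← tsub_le_iff_right]
  generalize hm : mergeOrder a a' - V.card = m
  obtain hm2 | hm2 := lt_or_ge m 2
  · exact (Nat.le_of_lt_succ hm2).trans (one_le_mergeOrder b b')
  have hma : m + V.card ≤ mergeOrder a a' := by omega
  obtain ⟨K, hK, K', hK', hKK'⟩ := (le_mergeOrder_iff_linked (by omega)).1 hma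
  obtain ⟨L, hL, hKL⟩ :=
    h m hm2 (hKK'.le_card_left.trans_eq (Community.card_eq hK)) K hK
  obtain ⟨L', hL', hKL'⟩ :=
    h' m hm2 (hKK'.symm.le_card_left.trans_eq (Community.card_eq hK')) K' hK'
  exact (le_mergeOrder_iff_linked hm2).2
    ⟨L, hL, L', hL', hKL.symm.trans ((hKK'.sdiff hV).trans hKL')⟩

theorem Shadows.birth_le (hV : (G'.spanningCoe \ G.spanningCoe).IsVertexCover V)
    (h : Shadows V a b) (h' : Shadows V b a') : birth a ≤ mergeOrder a a' + 2 * V.card := by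
  rw [← tsub_le_iff_right]
  generalize hm : birth a - 2 * V.card = m
  obtain hm2 | hm2 := lt_or_ge m 2
  · exact (Nat.le_of_lt_succ hm2).trans (one_le_mergeOrder a a')
  have hma : m + V.card + V.card ≤ birth a := by omega
  obtain ⟨K, hK⟩ := Community.nonempty_cliques (C := a.1)
    (le_trans (by omega : 2 ≤ m + V.card + V.card) hma)
  obtain ⟨L, hL, hKL⟩ := h (m + V.card) (by omega) hma K hK
  obtain ⟨M, hM, hLM⟩ :=
    h' m hm2 (hKL.symm.le_card_left.trans_eq (Community.card_eq hL)) L hL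
  have hshrink := (hKL.sdiff hV).trans hLM
  have hKshrink := linked_of_subset (Community.isKClique hK).2.isClique
    (Finset.sdiff_subset.trans Finset.sdiff_subset) hshrink.le_card_left
  exact (le_mergeOrder_iff_linked hm2).2 ⟨K, hK, M, hM, hKshrink.symm.trans hshrink⟩

end Shadows

theorem exists_interleaved {G' : Network α} {V : Finset α}
    (hV : (symmDiff G.spanningCoe G'.spanningCoe).IsVertexCover V)
    (hG : ∀ C : Community G, ∃ a : Leaf G, a.1.Nested C)
    (hG' : ∀ C : Community G', ∃ b : Leaf G', b.1.Nested C) :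
    ∃ (f : Leaf G → Leaf G') (g : Leaf G' → Leaf G),
      Interleaved V.card mergeOrder mergeOrder f g := by
  classical
  have hV₁ := hV.mono le_sup_left
  have hV₂ := hV.mono le_sup_right
  choose f hf using exists_shadows hV₁ hG'
  choose g hg using exists_shadows hV₂ hG
  exact ⟨f, g, {
    le_map_left := fun a a' => (hf a).mergeOrder_le hV₁ (hf a')
    le_map_right := fun b b' => (hg b).mergeOrder_le hV₂ (hg b')
    le_unit_left := fun a => mergeOrder_self a ▸ (hf a).birth_le hV₂ (hg (f a))
    le_unit_right := fun b => mergeOrder_self b ▸ (hg b).birth_le hV₁ (hf (g b)) }⟩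

end Tree

section StarNumbers

variable {α : Type u} {G G' : Network α}

theorem exists_card_eq_RSN (G' : Network α) (hG : G.verts.Finite) :
    ∃ V : Finset α, V.card = RSN G' G ∧ (G.spanningCoe \ G'.spanningCoe).IsVertexCover V := by
  have hne : {n | ∃ V : Finset α, V.card = n ∧
      ∀ e ∈ G.edgeSet \ G'.edgeSet, ∃ v ∈ V, v ∈ e}.Nonempty := by
    refine ⟨_, hG.toFinset, rfl, Sym2.ind fun v w h => ?_⟩
    exact ⟨v, hG.mem_toFinset.2 (G.edge_vert (SimpleGraph.Subgraph.mem_edgeSet.1 h.1)),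
      Sym2.mem_mk_left v w⟩
  obtain ⟨V, hcard, hV⟩ := Nat.sInf_mem hne
  refine ⟨V, hcard, fun v w hvw => ?_⟩
  obtain ⟨x, hxV, hx⟩ := hV s(v, w) hvw
  obtain rfl | rfl := Sym2.mem_iff.1 hx
  exacts [.inl hxV, .inr hxV]

theorem vertexCoverNum_symmDiff_le_TSN (hG : G.verts.Finite) (hG' : G'.verts.Finite) :
    (symmDiff G.spanningCoe G'.spanningCoe).vertexCoverNum ≤ TSN G' G := by
  obtain ⟨V, hVcard, hV⟩ := exists_card_eq_RSN G' hG
  obtain ⟨W, hWcard, hW⟩ := exists_card_eq_RSN G hG'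
  have hVW : (symmDiff G.spanningCoe G'.spanningCoe).IsVertexCover (V ∪ W : Set α) := by
    rintro v w (h | h)
    · exact (hV h).imp .inl .inl
    · exact (hW h).imp .inr .inr
  have hcard : (V ∪ W : Set α).encard ≤ V.card + W.card := by
    simpa only [Set.encard_coe_eq_coe_finsetCard] using Set.encard_union_le (V : Set α) W
  rw [hVcard, hWcard] at hcard
  exact hVW.vertexCoverNum_le.trans hcard

end StarNumbers

end CommunityTree

theorem theorem1_general {α : Type*} (G G' : CommunityTree.Network α)
    [Countable (CommunityTree.Leaf G)] [Countable (CommunityTree.Leaf G')]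
    (hG : ∀ C : CommunityTree.Community G, ∃ a : CommunityTree.Leaf G, a.1.Nested C)
    (hG' : ∀ C : CommunityTree.Community G', ∃ b : CommunityTree.Leaf G', b.1.Nested C)
    (elder : CommunityTree.Leaf G → CommunityTree.Leaf G → Prop)
    (helder : CommunityTree.IsElderRule G elder) (hwf : WellFounded elder)
    (elder' : CommunityTree.Leaf G' → CommunityTree.Leaf G' → Prop)
    (helder' : CommunityTree.IsElderRule G' elder') (hwf' : WellFounded elder') :
    CommunityTree.bottleneckDist (CommunityTree.diagramPoint G elder)
      (CommunityTree.diagramPoint G' elder') ≤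
        ((symmDiff G.spanningCoe G'.spanningCoe).vertexCoverNum : ENNReal) := by
  classical
  obtain ⟨V, hVcard, hV⟩ := (symmDiff G.spanningCoe G'.spanningCoe).vertexCoverNum_exists
  rw [← hVcard]
  obtain hfin | hinf := V.finite_or_infinite
  · lift V to Finset α using hfin
    obtain ⟨f, g, h⟩ := CommunityTree.exists_interleaved hV hG hG'
    have hmatching := h.isMatching
      (CommunityTree.isMergeTree_mergeOrder G) (CommunityTree.isMergeTree_mergeOrder G')
      (helder.isElderOrder hwf) (helder'.isElderOrder hwf')
    rw [CommunityTree.diagramPoint_eq_elderPoint, CommunityTree.diagramPoint_eq_elderPoint,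
      Set.encard_coe_eq_coe_finsetCard]
    exact hmatching.bottleneckDist_le
  · rw [hinf.encard_eq]
    exact le_top

theorem theorem1 {α : Type*} (G G' : CommunityTree.Network α)
    (hG : G.verts.Finite) (hG' : G'.verts.Finite)
    (elder : CommunityTree.Leaf G → CommunityTree.Leaf G → Prop)
    (helder : CommunityTree.IsElderRule G elder)
    (elder' : CommunityTree.Leaf G' → CommunityTree.Leaf G' → Prop)
    (helder' : CommunityTree.IsElderRule G' elder') :
    CommunityTree.bottleneckDist (CommunityTree.diagramPoint G elder)
      (CommunityTree.diagramPoint G' elder') ≤ (CommunityTree.TSN G' G : ENNReal) := by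
  have := CommunityTree.finite_leaf hG
  have := CommunityTree.finite_leaf hG'
  exact (theorem1_general G G' (CommunityTree.exists_leaf_nested hG)
    (CommunityTree.exists_leaf_nested hG') elder helder helder.wellFounded
    elder' helder' helder'.wellFounded).trans
    (ENat.toENNReal_le.2 (CommunityTree.vertexCoverNum_symmDiff_le_TSN hG hG'))
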